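/- Call a field $F$ a $C_1$-field if every homogeneous polynomial $f(x_1,\dots,x_m)$ with coefficients in $F$ of degree $d$ with $1\le d<m$ has a non-trivial zero in $F^m$. For a finite-dimensional associative (unital) $F$-algebra $A$ and a field extension $K/F$ (not necessarily algebraic), write $A_K = K\otimes_F A$. A finitely generated $A_K$-module $M$ is said to descend to (or to be defined over) an intermediate field $F\subset K_0\subset K$ if there is a finitely generated $A_{K_0}$-module $M_0$ such that $M\cong K\otimes_{K_0}M_0$ as $A_K$-modules. Proposition. Let $F$ be a $C_1$-field, $A$ a finite-dimensional associative $F$-algebra, $K/F$ a field extension, $M$ a finitely generated $A_K$-module, and $F\subset K_0\subset K$ an intermediate field with $[K_0:F]<\infty$. If $M^n$ descends to $K_0$ for some integer $n\ge 1$, then $M$ itself descends to $K_0$. -/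

import Mathlib

open scoped TensorProduct

/-- `F` is a `C₁`-field: every homogeneous polynomial over `F` of degree `d ≥ 1` in `n > d`
variables has a non-trivial zero in `F ^ n`. -/
def IsC1Field (F : Type*) [Field F] : Prop :=
  ∀ (n d : ℕ) (f : MvPolynomial (Fin n) F), 1 ≤ d → d < n → f.IsHomogeneous d →
    ∃ x : Fin n → F, x ≠ 0 ∧ MvPolynomial.eval x f = 0

/-- The extension of scalars `K ⊗[E] N` of a module `N` along `E → K`, as a type of its own. -/
def ScalarExt (E K N : Type*) [CommRing E] [CommRing K] [Algebra E K] [AddCommGroup N]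
    [Module E N] : Type _ :=
  K ⊗[E] N

namespace ScalarExt

section

variable (F A E K N : Type*) [CommRing F] [Ring A] [Algebra F A] [CommRing E] [Algebra F E]
  [CommRing K] [Algebra F K] [Algebra E K] [IsScalarTower F E K]
  [AddCommGroup N] [Module (E ⊗[F] A) N] [Module E N] [IsScalarTower E (E ⊗[F] A) N]

noncomputable instance : AddCommGroup (ScalarExt E K N) :=
  inferInstanceAs (AddCommGroup (K ⊗[E] N))

/-- The identity map from `K ⊗[E] N` to the type `ScalarExt E K N`. -/
def ofTensor : K ⊗[E] N ≃+ ScalarExt E K N :=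
  AddEquiv.refl _

/-- The action of `A` on `K ⊗[E] N` through the second factor. -/
noncomputable def rightAction : A →ₐ[F] Module.End K (K ⊗[E] N) :=
  letI : Algebra F (Module.End E N) := Algebra.compHom _ (algebraMap F E)
  haveI : IsScalarTower F E (Module.End E N) := IsScalarTower.of_algebraMap_eq fun _ => rfl
  (((Module.End.baseChangeHom E K N).restrictScalars F).comp
    ((Algebra.lsmul E E N).restrictScalars F)).comp
      (Algebra.TensorProduct.includeRight : A →ₐ[F] E ⊗[F] A)

theorem commute_rightAction (k : K) (a : A) :
    Commute (Algebra.ofId K (Module.End K (K ⊗[E] N)) k) (rightAction F A E K N a) :=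
  Algebra.commutes k _

/-- The action of `A_K = K ⊗[F] A` on `K ⊗[E] N`: `K` acts through the first factor and `A`
through the second, see `ScalarExt.smul_tmul`. -/
noncomputable def action : K ⊗[F] A →ₐ[K] Module.End K (K ⊗[E] N) :=
  Algebra.TensorProduct.lift (Algebra.ofId K _) (rightAction F A E K N)
    (commute_rightAction F A E K N)

/-- If `N` is an `A_E`-module then `K ⊗[E] N` is an `A_K`-module. -/
noncomputable instance : Module (K ⊗[F] A) (ScalarExt E K N) :=
  Module.compHom (K ⊗[E] N) (action F A E K N).toRingHom

/-- The action on pure tensors: `(k ⊗ a) • (x ⊗ y) = (k * x) ⊗ ((1 ⊗ a) • y)`. -/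
theorem smul_tmul (k x : K) (a : A) (y : N) :
    (k ⊗ₜ[F] a) • ofTensor E K N (x ⊗ₜ[E] y) =
      ofTensor E K N ((k * x) ⊗ₜ[E] (((1 : E) ⊗ₜ[F] a : E ⊗[F] A) • y)) := by
  have h : action F A E K N (k ⊗ₜ[F] a) =
      Algebra.ofId K (Module.End K (K ⊗[E] N)) k * rightAction F A E K N a := by
    rw [action, Algebra.TensorProduct.lift_tmul]
  exact LinearMap.congr_fun h (x ⊗ₜ[E] y)

end

end ScalarExt

universe uF uA uK uM

/-- The `A_K`-module `M` descends to (is defined over) the intermediate field `K₀` of `K / F`: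
there is a finitely generated `A_{K₀}`-module `M₀` with `M ≅ K ⊗[K₀] M₀` as `A_K`-modules.
The `K₀`-module structure on `M₀` is the one induced by `K₀ → K₀ ⊗[F] A` (this is what
`IsScalarTower` says). Such an `M₀` embeds into `M`, so that it is no restriction to take it in
the universe of `M`. -/
def DescendsTo {F : Type uF} (A : Type uA) {K : Type uK} [Field F] [Ring A] [Algebra F A]
    [Field K] [Algebra F K] (M : Type uM) [AddCommGroup M] [Module (K ⊗[F] A) M]
    (K₀ : IntermediateField F K) : Prop :=
  ∃ (M₀ : Type uM) (_ : AddCommGroup M₀) (_ : Module (K₀ ⊗[F] A) M₀) (_ : Module K₀ M₀)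
    (_ : IsScalarTower K₀ (K₀ ⊗[F] A) M₀),
    Module.Finite (K₀ ⊗[F] A) M₀ ∧ Nonempty (M ≃ₗ[K ⊗[F] A] ScalarExt K₀ K M₀)

/-!
Write `E` for `K₀`, let `M ^ n ≅ K ⊗ N` with an `A_E`-module `N`, and put `R = End N`, a
finite-dimensional `E`-algebra with `K ⊗ R = End (K ⊗ N)` (`ScalarExt.endTensorHom_injective`,
`ScalarExt.endTensorHom_surjective`). The first summand `M` is the image of an idempotent `e` of
`K ⊗ R`, and the unit of `K ⊗ R` is a sum of `n` orthogonal idempotents equivalent to `e`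
(`IsNthPart n e`). It suffices to find an idempotent `f` of `R` that is equivalent to `e` over `K`:
then `M` is the extension of scalars of the image of `f`.

Idempotents, and equivalences between them, lift along surjections with nil kernel
(`IdemEquiv.of_map`), so that `R` may be divided by its nilpotent Jacobson radical. By
Wedderburn–Artin it then is a product of matrix algebras over division algebras `D`. Here the
`C₁`-property enters: the `D` are commutative (`IsC1Field.mul_comm_of_finite`). Hence `K ⊗ D` is a
commutative Artinian ring, possibly with nilpotent elements as `D / E` may be inseparable, and the
image of the component of `e` in the matrices of size `r` over it is projective of constant rank
`r / n`, so free; thus `e` is equivalent to a diagonal matrix with entries `0` and `1`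
(`IsNthPart.idemEquiv_diagIdem`).

Commutativity of a division algebra `D` of dimension `m` over the `C₁`-field `F` is seen from its
norm form, of degree `m` in `m` variables and without non-trivial zero. Its value in the algebra
`D ⊗ F(X₁, …, X_m)`, which has no zero divisors, is the norm of the generic element `ξ`, that is
the `k`-th power of the norm of `ξ` from the commutative field `F(X₁, …, X_m)(ξ)`, where `k` is the
dimension of the algebra over this field. If `D` is not commutative then `k ≥ 2`, so that the norm
form is a power of a form of degree `m / k < m` in `m` variables, which has a non-trivial zero.
This avoids reduced norms, and also the theorem that finite extensions of `C₁`-fields are `C₁`,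
since division algebras over `E` are viewed as algebras over `F`.
-/

/-! ### Equivalence of idempotents -/

section Idempotents

variable {S T : Type*} [Ring S] [Ring T]

/-- Murray–von Neumann equivalence `e ∼ f` of idempotents: for idempotent endomorphisms of a module
it says that their images are isomorphic. -/
def IdemEquiv (e f : S) : Prop :=
  ∃ a b : S, a * b = e ∧ b * a = f

/-- The idempotent `e` is an `n`-th part of `1`: the maps `a p`, `b p` are the injections and the
projections of a decomposition of the unit into `n` orthogonal copies of `e`. For an idempotent
endomorphism of a module `V` it says that `V` is the direct sum of `n` copies of the image. -/
def IsNthPart (n : ℕ) (e : S) : Prop :=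
  ∃ a b : Fin n → S, (∀ p q, b p * a q = if p = q then e else 0) ∧ ∑ p, a p * b p = 1

theorem IdemEquiv.map {e f : S} (h : IdemEquiv e f) (φ : S →+* T) : IdemEquiv (φ e) (φ f) := by
  obtain ⟨a, b, rfl, rfl⟩ := h
  exact ⟨φ a, φ b, by simp, by simp⟩

theorem IsNthPart.map {n : ℕ} {e : S} (h : IsNthPart n e) (φ : S →+* T) : IsNthPart n (φ e) := by
  obtain ⟨a, b, h1, h2⟩ := h
  refine ⟨fun p => φ (a p), fun p => φ (b p), fun p q => ?_, ?_⟩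
  · rw [← map_mul, h1]; split_ifs <;> simp
  · simp_rw [← map_mul, ← map_sum, h2, map_one]

theorem IsNthPart.isIdempotentElem {n : ℕ} [NeZero n] {e : S} (h : IsNthPart n e) :
    IsIdempotentElem e := by
  obtain ⟨a, b, h1, h2⟩ := h
  have h3 : b 0 * (∑ p, a p * b p) * a 0 = e * e := by
    rw [Finset.mul_sum, Finset.sum_mul, Finset.sum_eq_single 0]
    · rw [← mul_assoc, h1, mul_assoc, h1, if_pos rfl]
    · intro q _ hq
      rw [← mul_assoc, h1, if_neg hq.symm, zero_mul, zero_mul]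
    · simp
  rw [h2, mul_one, h1, if_pos rfl] at h3
  exact h3.symm

/-- Equivalences of idempotents lift along surjections with nil kernel. -/
theorem IdemEquiv.of_map {φ : S →+* T} (hφ : Function.Surjective φ)
    (hker : ∀ x, φ x = 0 → IsNilpotent x) {e f : S} (he : IsIdempotentElem e)
    (hf : IsIdempotentElem f) (h : IdemEquiv (φ e) (φ f)) : IdemEquiv e f := by
  obtain ⟨a', b', hab, hba⟩ := h
  obtain ⟨a, rfl⟩ := hφ a'
  obtain ⟨b, rfl⟩ := hφ b'
  have he' : φ e * φ e = φ e := by rw [← map_mul, he.eq]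
  have hf' : φ f * φ f = φ f := by rw [← map_mul, hf.eq]
  have hea : φ e * φ a = φ a * φ f := by rw [← hab, ← hba, mul_assoc]
  have hfb : φ f * φ b = φ b * φ e := by rw [← hab, ← hba, mul_assoc]
  -- Cut `a` and `b` down to the corners; their product is then a unit of the corner `e S e`.
  obtain ⟨a₁, ha₁⟩ : ∃ a₁, a₁ = e * a * f := ⟨_, rfl⟩
  obtain ⟨b₁, hb₁⟩ : ∃ b₁, b₁ = f * b * e := ⟨_, rfl⟩
  have hea₁ : e * a₁ = a₁ := by simp only [ha₁, ← mul_assoc, he.eq]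
  have ha₁f : a₁ * f = a₁ := by simp only [ha₁, mul_assoc, hf.eq]
  have hfb₁ : f * b₁ = b₁ := by simp only [hb₁, ← mul_assoc, hf.eq]
  have hb₁e : b₁ * e = b₁ := by simp only [hb₁, mul_assoc, he.eq]
  have hφa : φ a₁ = φ a * φ f := by rw [ha₁, map_mul, map_mul, hea, mul_assoc, hf']
  have hφb : φ b₁ = φ b * φ e := by rw [hb₁, map_mul, map_mul, hfb, mul_assoc, he']
  have hφab : φ a₁ * φ b₁ = φ e := by
    rw [hφa, hφb, mul_assoc, ← mul_assoc (φ f), hfb, mul_assoc, he', ← mul_assoc, hab, he']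
  have hφba : φ b₁ * φ a₁ = φ f := by
    rw [hφa, hφb, mul_assoc, ← mul_assoc (φ e), hea, mul_assoc, hf', ← mul_assoc, hba, hf']
  obtain ⟨j, hj⟩ : ∃ j, j = a₁ * b₁ - e := ⟨_, rfl⟩
  have hej : e * j = j := by rw [hj, mul_sub, ← mul_assoc, hea₁, he.eq]
  have hje : j * e = j := by rw [hj, sub_mul, mul_assoc, hb₁e, he.eq]
  have hφj : φ j = 0 := by rw [hj, map_sub, map_mul, hφab, sub_self]
  obtain ⟨u, hu⟩ := (hker j hφj).isUnit_one_add
  have heu : e * (u : S) = a₁ * b₁ := by rw [hu, mul_add, mul_one, hej, hj]; abel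
  have hcomm : Commute e (u : S) := by
    rw [hu]; exact (Commute.one_right e).add_right (hej.trans hje.symm)
  have hcomm' : Commute e (↑u⁻¹ : S) := hcomm.units_inv_right
  have hφu : φ (↑u⁻¹ : S) = 1 := by
    have h1 : φ (u : S) = 1 := by rw [hu, map_add, map_one, hφj, add_zero]
    have h2 : φ (u : S) * φ (↑u⁻¹ : S) = 1 := by rw [← map_mul, u.mul_inv, map_one]
    rwa [h1, one_mul] at h2
  have hab₂ : a₁ * (b₁ * ↑u⁻¹) = e := by rw [← mul_assoc, ← heu, mul_assoc, u.mul_inv, mul_one]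
  obtain ⟨g, hg⟩ : ∃ g, g = b₁ * ↑u⁻¹ * a₁ := ⟨_, rfl⟩
  have hgg : g * g = g := by
    have : g * g = b₁ * ↑u⁻¹ * (a₁ * (b₁ * ↑u⁻¹)) * a₁ := by rw [hg]; simp only [mul_assoc]
    rw [this, hab₂, mul_assoc, hea₁, hg]
  have hfg : f * g = g := by rw [hg, ← mul_assoc, ← mul_assoc, hfb₁]
  have hgf : g * f = g := by rw [hg, mul_assoc, ha₁f]
  have hφg : φ g = φ f := by rw [hg, map_mul, map_mul, hφu, mul_one, hφba]
  -- `f - g` is an idempotent of the kernel.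
  have hfg0 : f - g = 0 := by
    refine IsIdempotentElem.eq_zero_of_isNilpotent ?_ (hker _ (by rw [map_sub, hφg, sub_self]))
    rw [IsIdempotentElem, sub_mul, mul_sub, mul_sub, hf.eq, hfg, hgf, hgg, sub_self, sub_zero]
  exact ⟨a₁, b₁ * ↑u⁻¹, hab₂, by rw [← hg, ← sub_eq_zero.mp hfg0]⟩

theorem IdemEquiv.pi {ι : Type*} {R : ι → Type*} [∀ i, Ring (R i)] {e f : ∀ i, R i}
    (h : ∀ i, IdemEquiv (e i) (f i)) : IdemEquiv e f := by
  choose a b hab hba using h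
  exact ⟨a, b, funext hab, funext hba⟩

end Idempotents

/-! ### Matrices over a commutative semilocal ring -/

section Matrices

open Matrix

/-- The diagonal idempotent matrix of size `r` and rank `s`. -/
def diagIdem (C : Type*) [Ring C] (r s : ℕ) : Matrix (Fin r) (Fin r) C :=
  Matrix.diagonal fun i => if (i : ℕ) < s then 1 else 0

theorem isIdempotentElem_diagIdem (C : Type*) [Ring C] (r s : ℕ) :
    IsIdempotentElem (diagIdem C r s) := by
  rw [IsIdempotentElem, diagIdem, Matrix.diagonal_mul_diagonal]
  congr 1; ext i; split_ifs <;> simp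

/-- The image of an `n`-th part of the identity of `V` is an `n`-th part of `V`. -/
theorem IsNthPart.nonempty_linearEquiv {C V : Type*} [Ring C] [AddCommGroup V] [Module C V] {n : ℕ}
    [NeZero n] {e : Module.End C V} (h : IsNthPart n e) :
    Nonempty ((Fin n → LinearMap.range e) ≃ₗ[C] V) := by
  have he := h.isIdempotentElem
  obtain ⟨a, b, h1, h2⟩ := h
  have hb : ∀ p x, b p x ∈ LinearMap.range e := by
    intro p x
    have : b p = e * b p := by
      calc b p = b p * ∑ q, a q * b q := by rw [h2, mul_one]
        _ = ∑ q, b p * a q * b q := by rw [Finset.mul_sum]; simp only [mul_assoc]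
        _ = e * b p := by simp [h1, ite_mul]
    rw [this]
    exact ⟨b p x, rfl⟩
  refine ⟨LinearEquiv.ofLinearMap
    (∑ p, a p ∘ₗ (LinearMap.range e).subtype ∘ₗ LinearMap.proj p)
    (LinearMap.pi fun p => (b p).codRestrict _ (hb p)) ?_ ?_⟩
  · ext x
    simpa [Module.End.mul_apply] using LinearMap.congr_fun h2 x
  · refine LinearMap.ext fun x => funext fun p => Subtype.ext ?_
    obtain ⟨y, hy⟩ := (x p).2
    have h3 : ∀ q, b p (a q (x q)) = if p = q then e (x q) else 0 := by
      intro q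
      rw [← Module.End.mul_apply, h1]
      split_ifs <;> rfl
    have h4 : e (x p) = x p := by rw [← hy, ← Module.End.mul_apply, he.eq]
    simp [h3, h4]

variable {C : Type*} [CommRing C]

/-- Over a commutative semilocal ring the image of an `n`-th part of the unit matrix of size `r` is
a finitely generated projective module of constant rank `r / n`, hence free. -/
theorem IsNthPart.exists_linearEquiv_range [Nontrivial C] [Finite (MaximalSpectrum C)] {n r : ℕ}
    [NeZero n] {e : Module.End C (Fin r → C)} (h : IsNthPart n e) :
    Nonempty ((Fin (r / n) → C) ≃ₗ[C] LinearMap.range e) := by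
  have he := h.isIdempotentElem
  obtain ⟨ψ⟩ := h.nonempty_linearEquiv
  have hn : 0 < n := Nat.pos_of_ne_zero (NeZero.ne n)
  have hproj : Module.Projective C (LinearMap.range e) :=
    Module.Projective.of_split (LinearMap.range e).subtype e.rangeRestrict (by
      ext ⟨x, y, rfl⟩ : 2
      exact LinearMap.congr_fun he.eq y)
  have hfin : Module.Finite C (LinearMap.range e) := inferInstance
  have hrk : ∀ m : MaximalSpectrum C, Module.finrank (C ⧸ m.asIdeal)
      ((C ⧸ m.asIdeal) ⊗[C] LinearMap.range e) = r / n := by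
    intro m
    let _ : Field (C ⧸ m.asIdeal) := Ideal.Quotient.field m.asIdeal
    have h1 := (((TensorProduct.piRight C (C ⧸ m.asIdeal) (C ⧸ m.asIdeal)
      (fun _ : Fin n => LinearMap.range e)).symm.trans
      (LinearEquiv.baseChange C (C ⧸ m.asIdeal) _ _ ψ)).trans
      (TensorProduct.piScalarRight C (C ⧸ m.asIdeal) (C ⧸ m.asIdeal) (Fin r))).finrank_eq
    rw [Module.finrank_pi_fintype, Module.finrank_fin_fun] at h1
    simp only [Finset.sum_const, Finset.card_univ, Fintype.card_fin, smul_eq_mul] at h1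
    exact (Nat.div_eq_of_eq_mul_right hn h1.symm).symm
  have hfree := Module.free_of_flat_of_finrank_eq C (LinearMap.range e) (r / n) hrk
  have h1 := ψ.finrank_eq
  rw [Module.finrank_pi_fintype, Module.finrank_fin_fun] at h1
  simp only [Finset.sum_const, Finset.card_univ, Fintype.card_fin, smul_eq_mul] at h1
  refine ⟨LinearEquiv.ofFinrankEq _ _ ?_⟩
  rw [Module.finrank_fin_fun, Nat.div_eq_of_eq_mul_right hn h1.symm]

/-- Over a commutative semilocal ring an `n`-th part of the unit matrix of size `r` is equivalent to
a diagonal idempotent of rank `r / n`. -/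
theorem IsNthPart.idemEquiv_diagIdem [Nontrivial C] [Finite (MaximalSpectrum C)] {n r : ℕ}
    [NeZero n] {e : Matrix (Fin r) (Fin r) C} (h : IsNthPart n e) :
    IdemEquiv e (diagIdem C r (r / n)) := by
  let Φ : Matrix (Fin r) (Fin r) C ≃ₐ[C] Module.End C (Fin r → C) := Matrix.toLinAlgEquiv'
  have hE : IsNthPart n (Φ e) := h.map (Φ : _ →+* Module.End C (Fin r → C))
  have hidem := hE.isIdempotentElem
  obtain ⟨ψ⟩ := hE.exists_linearEquiv_range
  have hs : r / n ≤ r := Nat.div_le_self r n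
  let u : (Fin (r / n) → C) →ₗ[C] (Fin r → C) := (LinearMap.range (Φ e)).subtype ∘ₗ ψ.toLinearMap
  let v : (Fin r → C) →ₗ[C] (Fin (r / n) → C) := ψ.symm.toLinearMap ∘ₗ (Φ e).rangeRestrict
  have huv : u ∘ₗ v = Φ e := by ext; simp [u, v]
  have hvu : v ∘ₗ u = LinearMap.id := by
    refine LinearMap.ext fun x => ψ.injective (Subtype.ext ?_)
    obtain ⟨y, hy⟩ := (ψ x).2
    simp only [u, v, LinearMap.comp_apply, LinearEquiv.coe_coe, LinearEquiv.apply_symm_apply,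
      LinearMap.codRestrict_apply, Submodule.subtype_apply, LinearMap.id_apply,
      LinearMap.rangeRestrict]
    rw [← hy]
    exact LinearMap.congr_fun hidem.eq y
  let u' : (Fin (r / n) → C) →ₗ[C] (Fin r → C) :=
    LinearMap.pi fun i => if hi : (i : ℕ) < r / n then LinearMap.proj ⟨i, hi⟩ else 0
  let v' : (Fin r → C) →ₗ[C] (Fin (r / n) → C) := LinearMap.funLeft C C (Fin.castLE hs)
  have huv' : u' ∘ₗ v' = Φ (diagIdem C r (r / n)) := by
    refine LinearMap.ext fun x => funext fun i => ?_
    simp only [u', v', Φ, diagIdem, LinearMap.comp_apply, LinearMap.pi_apply,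
      Matrix.toLinAlgEquiv'_apply, Matrix.mulVec_diagonal]
    split_ifs with hi
    · simp [LinearMap.funLeft_apply]
    · simp
  have hvu' : v' ∘ₗ u' = LinearMap.id := by
    refine LinearMap.ext fun x => funext fun i => ?_
    simp [u', v', LinearMap.funLeft_apply]
  have key : IdemEquiv (Φ e) (Φ (diagIdem C r (r / n))) := by
    refine ⟨u ∘ₗ v', u' ∘ₗ v, ?_, ?_⟩
    · rw [Module.End.mul_eq_comp, LinearMap.comp_assoc, ← LinearMap.comp_assoc v u' v', hvu',
        LinearMap.id_comp, huv]
    · rw [Module.End.mul_eq_comp, LinearMap.comp_assoc, ← LinearMap.comp_assoc v' u v, hvu,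
        LinearMap.id_comp, huv']
  simpa using key.map (Φ.symm : Module.End C (Fin r → C) →+* Matrix (Fin r) (Fin r) C)

end Matrices

/-! ### Base change of finite-dimensional algebras -/

universe uR

section BaseChange

variable {E K : Type*} [Field E] [Field K] [Algebra E K]

/-- Extension of scalars commutes with the formation of matrix algebras. -/
noncomputable def tensorMatrixAlgEquiv (E K D : Type*) [Field E] [Field K] [Algebra E K] [Ring D]
    [Algebra E D] (r : ℕ) :
    K ⊗[E] Matrix (Fin r) (Fin r) D ≃ₐ[E] Matrix (Fin r) (Fin r) (K ⊗[E] D) :=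
  ((Algebra.TensorProduct.congr AlgEquiv.refl (matrixEquivTensor (Fin r) E D)).trans
    (Algebra.TensorProduct.assoc E E E K D (Matrix (Fin r) (Fin r) E)).symm).trans
    (matrixEquivTensor (Fin r) E (K ⊗[E] D)).symm

theorem tensorMatrixAlgEquiv_one_tmul {D : Type*} [Ring D] [Algebra E D] {r : ℕ}
    (f : Matrix (Fin r) (Fin r) D) :
    tensorMatrixAlgEquiv E K D r (1 ⊗ₜ[E] f) = f.map fun x => 1 ⊗ₜ[E] x := by
  ext i j
  simp [tensorMatrixAlgEquiv, TensorProduct.tmul_sum, Matrix.sum_apply, Matrix.single_apply,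
    Fintype.sum_prod_type]
  rw [Finset.sum_eq_single i (by simp +contextual) (by simp),
    Finset.sum_eq_single j (by simp +contextual) (by simp), if_pos ⟨rfl, rfl⟩]

theorem tensorMatrixAlgEquiv_one_tmul_diagIdem {D : Type*} [Ring D] [Algebra E D] {r s : ℕ} :
    tensorMatrixAlgEquiv E K D r (1 ⊗ₜ[E] diagIdem D r s) = diagIdem (K ⊗[E] D) r s := by
  rw [tensorMatrixAlgEquiv_one_tmul, diagIdem, diagIdem, Matrix.diagonal_map (by simp)]
  congr 1; ext i
  split_ifs <;> simp [Algebra.TensorProduct.one_def]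

/-- After base change to `K`, an `n`-th part of the unit matrix over a finite-dimensional
commutative division algebra `D` is equivalent to an idempotent defined over `D`: the ring `K ⊗ D`
is commutative and semilocal. -/
theorem IsNthPart.exists_idemEquiv_tmul_matrix {D : Type*} [DivisionRing D] [Algebra E D]
    [Module.Finite E D] (hD : ∀ x y : D, x * y = y * x) {n r : ℕ} [NeZero n]
    {e : K ⊗[E] Matrix (Fin r) (Fin r) D} (h : IsNthPart n e) :
    ∃ f : Matrix (Fin r) (Fin r) D, IsIdempotentElem f ∧ IdemEquiv e (1 ⊗ₜ[E] f) := by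
  let _ : Field D := { ‹DivisionRing D› with mul_comm := hD }
  have : IsArtinianRing (K ⊗[E] D) := IsArtinianRing.of_finite K _
  let Φ := tensorMatrixAlgEquiv E K D r
  have h1 : IsNthPart n (Φ e) := h.map (Φ : _ →+* Matrix (Fin r) (Fin r) (K ⊗[E] D))
  refine ⟨diagIdem D r (r / n), isIdempotentElem_diagIdem D r _, ?_⟩
  have h2 := h1.idemEquiv_diagIdem
  rw [← tensorMatrixAlgEquiv_one_tmul_diagIdem] at h2
  have h3 := h2.map ((Φ.symm : Matrix (Fin r) (Fin r) (K ⊗[E] D) ≃ₐ[E] _) :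
    Matrix (Fin r) (Fin r) (K ⊗[E] D) →+* K ⊗[E] Matrix (Fin r) (Fin r) D)
  simpa [Φ] using h3

theorem IsNthPart.exists_idemEquiv_tmul_pi {ι : Type*} [Finite ι] {S : ι → Type*}
    [∀ i, Ring (S i)] [∀ i, Algebra E (S i)] {n : ℕ}
    (hS : ∀ i (e : K ⊗[E] S i), IsNthPart n e →
      ∃ f : S i, IsIdempotentElem f ∧ IdemEquiv e (1 ⊗ₜ[E] f))
    {e : K ⊗[E] (∀ i, S i)} (h : IsNthPart n e) :
    ∃ f : ∀ i, S i, IsIdempotentElem f ∧ IdemEquiv e (1 ⊗ₜ[E] f) := by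
  classical
  have := Fintype.ofFinite ι
  let Φ := Algebra.TensorProduct.piRight E E K S
  have h1 : IsNthPart n (Φ e) := h.map (Φ : _ →+* ∀ i, K ⊗[E] S i)
  choose f hf hef using fun i => hS i (Φ e i) (h1.map (Pi.evalRingHom _ i))
  refine ⟨f, funext hf, ?_⟩
  have h2 : IdemEquiv (Φ e) (Φ (1 ⊗ₜ f)) := by
    rw [Algebra.TensorProduct.piRight_tmul]
    exact IdemEquiv.pi hef
  have h3 := h2.map (Φ.symm : (∀ i, K ⊗[E] S i) →+* K ⊗[E] (∀ i, S i))
  simpa using h3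

theorem IsNthPart.exists_idemEquiv_tmul_of_algEquiv {R S : Type*} [Ring R] [Ring S] [Algebra E R]
    [Algebra E S] (Ψ : R ≃ₐ[E] S) {n : ℕ}
    (hS : ∀ e : K ⊗[E] S, IsNthPart n e → ∃ f : S, IsIdempotentElem f ∧ IdemEquiv e (1 ⊗ₜ[E] f))
    {e : K ⊗[E] R} (h : IsNthPart n e) :
    ∃ f : R, IsIdempotentElem f ∧ IdemEquiv e (1 ⊗ₜ[E] f) := by
  let Φ : K ⊗[E] R ≃ₐ[E] K ⊗[E] S := Algebra.TensorProduct.congr AlgEquiv.refl Ψ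
  obtain ⟨f, hf, hef⟩ := hS (Φ e) (h.map (Φ : K ⊗[E] R →+* K ⊗[E] S))
  refine ⟨Ψ.symm f, hf.map Ψ.symm, ?_⟩
  have h3 := hef.map (Φ.symm : K ⊗[E] S →+* K ⊗[E] R)
  have h4 : Φ.symm (1 ⊗ₜ f) = 1 ⊗ₜ Ψ.symm f := by
    rw [AlgEquiv.symm_apply_eq]; simp [Φ]
  simpa [h4] using h3

/-- The kernel of `K ⊗ R → K ⊗ R / J` is nil if `J` is a nilpotent ideal. -/
theorem isNilpotent_of_map_mkₐ_eq_zero {R : Type*} [Ring R] [Algebra E R] (J : Ideal R)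
    [J.IsTwoSided] (hJ : IsNilpotent J) (x : K ⊗[E] R)
    (hx : Algebra.TensorProduct.map (AlgHom.id E K) (Ideal.Quotient.mkₐ E J) x = 0) :
    IsNilpotent x := by
  -- The image of `K ⊗ J ^ k`, as the `K`-span of `J ^ k`.
  let U : ℕ → Submodule K (K ⊗[E] R) := fun k =>
    Submodule.span K ((fun j : R => (1 : K) ⊗ₜ[E] j) '' (J ^ k : Ideal R))
  have hU : ∀ k, U k * U 1 ≤ U (k + 1) := by
    intro k
    simp only [U]
    rw [Submodule.span_mul_span, Submodule.span_le]
    rintro _ ⟨_, ⟨a, ha, rfl⟩, _, ⟨b, hb, rfl⟩, rfl⟩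
    refine Submodule.subset_span ⟨a * b, ?_, by simp⟩
    rw [SetLike.mem_coe, Submodule.pow_succ]
    exact Ideal.mul_mem_mul ha (by rwa [Submodule.pow_one] at hb)
  have hx1 : x ∈ U 1 := by
    have hex : Function.Exact (J.restrictScalars E).subtype
        (Ideal.Quotient.mkₐ E J).toLinearMap := by
      intro y
      simp [Ideal.Quotient.eq_zero_iff_mem]
    have := lTensor_exact K hex (Ideal.Quotient.mkₐ_surjective E J)
    obtain ⟨z, rfl⟩ := (this x).mp hx
    clear hx
    induction z with
    | zero => simp
    | add a b ha hb => rw [map_add]; exact add_mem ha hb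
    | tmul k j =>
      have : k ⊗ₜ[E] (j : R) = k • ((1 : K) ⊗ₜ[E] (j : R)) := by
        rw [TensorProduct.smul_tmul', smul_eq_mul, mul_one]
      rw [LinearMap.lTensor_tmul]
      simp only [Submodule.subtype_apply]
      rw [this]
      exact Submodule.smul_mem _ _
        (Submodule.subset_span ⟨j, by rw [Submodule.pow_one]; exact j.2, rfl⟩)
  have hpow : ∀ k, x ^ (k + 1) ∈ U (k + 1) := by
    intro k
    induction k with
    | zero => simpa using hx1
    | succ k ih => rw [pow_succ]; exact hU _ (Submodule.mul_mem_mul ih hx1)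
  obtain ⟨k, hk⟩ := hJ
  refine ⟨k + 1, ?_⟩
  have h0 : U (k + 1) = ⊥ := by
    have hk' : J ^ (k + 1) = ⊥ := by
      rw [Submodule.pow_succ, hk, Submodule.zero_eq_bot, Submodule.bot_mul]
    simp [U, hk']
  simpa [h0] using hpow k

/-- Let `R` be a finite-dimensional algebra over `E` such that all finite-dimensional division
algebras over `E` are commutative. Then each `n`-th part of `1` in `K ⊗ R` is equivalent to an
idempotent of `R`. -/
theorem IsNthPart.exists_idemEquiv_tmul {R : Type uR} [Ring R] [Algebra E R] [Module.Finite E R]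
    (hE : ∀ (D : Type uR) [DivisionRing D] [Algebra E D] [Module.Finite E D] (x y : D),
      x * y = y * x) {n : ℕ} [NeZero n] {e : K ⊗[E] R} (h : IsNthPart n e) :
    ∃ f : R, IsIdempotentElem f ∧ IdemEquiv e (1 ⊗ₜ[E] f) := by
  have hart : IsArtinianRing R := IsArtinianRing.of_finite E R
  let J := Ring.jacobson R
  have hJ : IsNilpotent J := IsSemiprimaryRing.isNilpotent
  have : Module.Finite E (R ⧸ J) := inferInstance
  obtain ⟨m, D, d, _, _, _, _, ⟨Ψ⟩⟩ :=
    IsSemisimpleRing.exists_algEquiv_pi_matrix_divisionRing_finite E (R ⧸ J)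
  let φ : K ⊗[E] R →ₐ[E] K ⊗[E] (R ⧸ J) :=
    Algebra.TensorProduct.map (AlgHom.id E K) (Ideal.Quotient.mkₐ E J)
  have hφ : Function.Surjective φ :=
    TensorProduct.map_surjective Function.surjective_id (Ideal.Quotient.mkₐ_surjective E J)
  obtain ⟨f', hf', hef'⟩ := IsNthPart.exists_idemEquiv_tmul_of_algEquiv Ψ
    (fun e he => IsNthPart.exists_idemEquiv_tmul_pi
      (fun i e he => IsNthPart.exists_idemEquiv_tmul_matrix (hE (D i)) he) he)
    (h.map (φ : K ⊗[E] R →+* K ⊗[E] (R ⧸ J)))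
  have hker : ∀ x ∈ RingHom.ker (Ideal.Quotient.mk J), IsNilpotent x := by
    intro x hx
    obtain ⟨k, hk⟩ := hJ
    rw [Ideal.mk_ker] at hx
    exact ⟨k, by simpa [hk] using Ideal.pow_mem_pow hx k⟩
  obtain ⟨f, hf, rfl⟩ := exists_isIdempotentElem_eq_of_ker_isNilpotent (Ideal.Quotient.mk J) hker f'
    (Ideal.Quotient.mk_surjective f') hf'
  refine ⟨f, hf, IdemEquiv.of_map (φ := (φ : K ⊗[E] R →+* K ⊗[E] (R ⧸ J))) hφ
    (isNilpotent_of_map_mkₐ_eq_zero J hJ) h.isIdempotentElem ?_ ?_⟩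
  · rw [IsIdempotentElem, Algebra.TensorProduct.tmul_mul_tmul, mul_one, hf.eq]
  · simpa [φ] using hef'

end BaseChange

/-! ### Generic elements of division algebras -/

section Generic

variable {F D : Type*} [Field F] [Ring D] [Algebra F D] {σ : Type*}

theorem AddMonoidAlgebra.commute_mapAlgHom_singleZeroAlgHom (p : MvPolynomial σ F) (d : D) :
    Commute (AddMonoidAlgebra.mapAlgHom (σ →₀ ℕ) (Algebra.ofId F D) p :
        AddMonoidAlgebra D (σ →₀ ℕ))
      (AddMonoidAlgebra.singleZeroAlgHom (R := F) (A := D) (M := σ →₀ ℕ) d) := by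
  induction p using AddMonoidAlgebra.induction_linear with
  | zero => simp
  | add p q hp hq => rw [map_add]; exact hp.add_left hq
  | single s c =>
    rw [Commute, SemiconjBy]
    simp [AddMonoidAlgebra.single_mul_single, Algebra.commutes c d, Algebra.ofId_apply]

/-- The canonical map from `F[X] ⊗ D` to the polynomials with coefficients in the (not necessarily
commutative) algebra `D`. -/
noncomputable def mvPolynomialTensorHom (F D σ : Type*) [Field F] [Ring D] [Algebra F D] :
    MvPolynomial σ F ⊗[F] D →ₐ[F] AddMonoidAlgebra D (σ →₀ ℕ) :=
  Algebra.TensorProduct.lift (AddMonoidAlgebra.mapAlgHom (σ →₀ ℕ) (Algebra.ofId F D))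
    (AddMonoidAlgebra.singleZeroAlgHom (R := F) (A := D) (M := σ →₀ ℕ))
    AddMonoidAlgebra.commute_mapAlgHom_singleZeroAlgHom

theorem mvPolynomialTensorHom_injective :
    Function.Injective (mvPolynomialTensorHom F D σ) := by
  let Ψ : AddMonoidAlgebra D (σ →₀ ℕ) →+ MvPolynomial σ F ⊗[F] D :=
    AddMonoidAlgebra.liftNC
      ((Algebra.TensorProduct.includeRight : D →ₐ[F] MvPolynomial σ F ⊗[F] D) :
        D →+ MvPolynomial σ F ⊗[F] D)
      (fun s => MvPolynomial.monomial s.toAdd (1 : F) ⊗ₜ[F] (1 : D))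
  refine Function.LeftInverse.injective (g := Ψ) fun z => ?_
  induction z with
  | zero => simp
  | add x y hx hy => rw [map_add, map_add, hx, hy]
  | tmul p d =>
    induction p using AddMonoidAlgebra.induction_linear with
    | zero => simp
    | add p q hp hq => rw [TensorProduct.add_tmul, map_add, map_add, hp, hq]
    | single s c =>
      have h1 : mvPolynomialTensorHom F D σ (AddMonoidAlgebra.single s c ⊗ₜ[F] d) =
          AddMonoidAlgebra.single s (c • d) := by
        simp [mvPolynomialTensorHom, AddMonoidAlgebra.single_mul_single, Algebra.ofId_apply,
          Algebra.smul_def]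
      have h2 : (AddMonoidAlgebra.single s c : MvPolynomial σ F) =
          c • MvPolynomial.monomial s 1 := by
        rw [MvPolynomial.smul_monomial, smul_eq_mul, mul_one]; rfl
      rw [h1, h2, TensorProduct.smul_tmul]
      simp [Ψ, AddMonoidAlgebra.liftNC_single, smul_mul_assoc]

instance MvPolynomial.noZeroDivisors_tensor [NoZeroDivisors D] :
    NoZeroDivisors (MvPolynomial σ F ⊗[F] D) :=
  (mvPolynomialTensorHom_injective (F := F) (D := D) (σ := σ)).noZeroDivisors
    (mvPolynomialTensorHom F D σ) (map_zero _) (map_mul _)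

/-- A division algebra stays without zero divisors over a purely transcendental extension. -/
theorem noZeroDivisors_fractionRing_tensor [NoZeroDivisors D] :
    NoZeroDivisors (FractionRing (MvPolynomial σ F) ⊗[F] D) := by
  let P := MvPolynomial σ F
  let Q := FractionRing P
  let ι : P ⊗[F] D →ₐ[F] Q ⊗[F] D :=
    Algebra.TensorProduct.map (IsScalarTower.toAlgHom F P Q) (AlgHom.id F D)
  have hι : Function.Injective ι :=
    Module.Flat.rTensor_preserves_injective_linearMap
      (IsScalarTower.toAlgHom F P Q).toLinearMap (IsFractionRing.injective P Q)
  -- Clearing denominators.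
  have hden : ∀ z : Q ⊗[F] D, ∃ s : P, s ≠ 0 ∧ ∃ w, algebraMap P Q s • z = ι w := by
    intro z
    induction z with
    | zero => exact ⟨1, one_ne_zero, 0, by simp⟩
    | tmul q d =>
      obtain ⟨a, s, hs, rfl⟩ := IsFractionRing.div_surjective (A := P) q
      have hs0 : s ≠ 0 := nonZeroDivisors.ne_zero hs
      refine ⟨s, hs0, a ⊗ₜ d, ?_⟩
      have : algebraMap P Q s ≠ 0 := by simpa using hs0
      rw [TensorProduct.smul_tmul', smul_eq_mul, mul_div_cancel₀ _ this]
      simp [ι]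
    | add x y hx hy =>
      obtain ⟨s, hs, w, hw⟩ := hx
      obtain ⟨t, ht, v, hv⟩ := hy
      refine ⟨s * t, mul_ne_zero hs ht, (t ⊗ₜ 1) * w + (s ⊗ₜ 1) * v, ?_⟩
      have h1 : ∀ (a : P) w, ι ((a ⊗ₜ 1) * w) = algebraMap P Q a • ι w := by
        intro a w
        have h2 : ι (a ⊗ₜ 1) = algebraMap Q (Q ⊗[F] D) (algebraMap P Q a) := by simp [ι]
        rw [map_mul, h2, ← Algebra.smul_def]
      rw [map_add, h1, h1, ← hw, ← hv, smul_smul, smul_smul, smul_add, map_mul,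
        mul_comm (algebraMap P Q t)]
  refine ⟨fun {z z'} h => ?_⟩
  obtain ⟨s, hs, w, hw⟩ := hden z
  obtain ⟨t, ht, v, hv⟩ := hden z'
  have h0 : ι (w * v) = 0 := by
    rw [map_mul, ← hw, ← hv, smul_mul_smul_comm, h, smul_zero]
  have hne : ∀ a : P, a ≠ 0 → algebraMap P Q a ≠ 0 := fun a ha => by simpa using ha
  rcases mul_eq_zero.mp ((map_eq_zero_iff ι hι).mp h0) with h1 | h1
  · left
    rw [h1, map_zero] at hw
    exact (smul_eq_zero.mp hw).resolve_left (hne s hs)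
  · right
    rw [h1, map_zero] at hv
    exact (smul_eq_zero.mp hv).resolve_left (hne t ht)

open scoped IsMulCommutative in
/-- In a noncommutative finite-dimensional division algebra `B` over `Q` each norm is a proper
power: if `L` is the field generated by `x`, then `B` is an `L`-vector space of dimension
`k ≥ 2`, and the norm of `x` from `B` is the `k`-th power of its norm from `L`. -/
theorem Algebra.exists_norm_eq_pow {Q B : Type*} [Field Q] [Ring B] [Algebra Q B]
    [Module.Finite Q B] [NoZeroDivisors B] (hB : ∃ x y : B, x * y ≠ y * x) (x : B) :
    ∃ (c : Q) (k : ℕ), 2 ≤ k ∧ Algebra.norm Q x = c ^ k := by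
  have : Nontrivial B := by
    obtain ⟨x, y, h⟩ := hB
    exact ⟨_, _, h⟩
  have : IsDomain B := NoZeroDivisors.to_isDomain B
  let L := Algebra.adjoin Q {x}
  have hdom : IsDomain L := inferInstance
  let _ : Field L := fieldOfFiniteDimensional Q L
  have hfin : Module.Finite L B := Module.Finite.of_restrictScalars_finite Q L B
  let x' : L := ⟨x, Algebra.self_mem_adjoin_singleton Q x⟩
  refine ⟨Algebra.norm Q x', Module.finrank L B, ?_, ?_⟩
  · -- An algebra of dimension `1` over the commutative ring `L` would be commutative.
    have hpos : 0 < Module.finrank L B := Module.finrank_pos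
    by_contra! hlt
    have h1 : Module.finrank L B = 1 := by omega
    obtain ⟨x, y, hxy⟩ := hB
    rw [finrank_eq_one_iff_of_nonzero' (1 : B) one_ne_zero] at h1
    obtain ⟨a, rfl⟩ := h1 x
    obtain ⟨b, rfl⟩ := h1 y
    apply hxy
    simp only [Subalgebra.smul_def, smul_eq_mul, mul_one]
    exact congrArg Subtype.val (mul_comm a b)
  · have h1 : (Algebra.lmul Q B x : B →ₗ[Q] B) =
        (x' • (LinearMap.id : B →ₗ[L] B)).restrictScalars Q := by
      ext y
      simp [x', Subalgebra.smul_def]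
    rw [Algebra.norm_apply, h1, LinearMap.det_restrictScalars, LinearMap.det_smul]
    simp

end Generic

/-! ### Division algebras over `C₁`-fields -/

section C1

/-- A polynomial some power of which is a non-zero form can be replaced by a form with the same
power: the top homogeneous component. -/
theorem MvPolynomial.exists_isHomogeneous_pow_eq {R σ : Type*} [CommRing R] [IsDomain R]
    {p q : MvPolynomial σ R} {m k : ℕ} (hp : p.IsHomogeneous m) (hp0 : p ≠ 0) (h : q ^ k = p) :
    ∃ (q' : MvPolynomial σ R) (j : ℕ), q'.IsHomogeneous j ∧ q' ^ k = p ∧ j * k = m := by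
  -- The substitution `X i ↦ X i * t` turns the grading into the grading by powers of `t`.
  let θ : MvPolynomial σ R →ₐ[R] Polynomial (MvPolynomial σ R) :=
    MvPolynomial.aeval fun i => Polynomial.C (MvPolynomial.X i) * Polynomial.X
  have hmon : ∀ s a, θ (MvPolynomial.monomial s a) =
      Polynomial.monomial s.degree (MvPolynomial.monomial s a) := by
    intro s a
    rw [MvPolynomial.aeval_monomial, ← Polynomial.C_mul_X_pow_eq_monomial,
      MvPolynomial.monomial_eq, map_mul, Finsupp.prod, Finsupp.prod, map_prod]
    simp only [mul_pow, Finset.prod_mul_distrib, map_pow, Finset.prod_pow_eq_pow_sum]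
    rw [mul_assoc]
    rfl
  have hθ : ∀ (f : MvPolynomial σ R) i, (θ f).coeff i = MvPolynomial.homogeneousComponent i f := by
    intro f i
    induction f using AddMonoidAlgebra.induction_linear with
    | zero => simp
    | add p q hp hq => rw [map_add, map_add, Polynomial.coeff_add, hp, hq]
    | single s a =>
      refine (congrArg (Polynomial.coeff · i) (hmon s a)).trans ?_
      rw [Polynomial.coeff_monomial]
      refine Eq.trans ?_ (MvPolynomial.homogeneousComponent_of_mem
        (MvPolynomial.isHomogeneous_monomial a rfl)).symm
      simp only [eq_comm]
  have hpθ : θ p = Polynomial.monomial m p := by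
    ext1 i
    rw [hθ, Polynomial.coeff_monomial, MvPolynomial.homogeneousComponent_of_mem hp]
    simp only [eq_comm]
  have hlead : (θ q).leadingCoeff ^ k = p := by
    rw [← Polynomial.leadingCoeff_pow, ← map_pow, h, hpθ, Polynomial.leadingCoeff_monomial]
  have hhom : (θ q).leadingCoeff.IsHomogeneous (θ q).natDegree := by
    rw [Polynomial.leadingCoeff, hθ]
    exact MvPolynomial.homogeneousComponent_isHomogeneous _ _
  exact ⟨_, _, hhom, hlead, (hlead ▸ hhom.pow k).inj_right hp hp0⟩

variable {F D : Type*} [Field F]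

/-- The norm form of a finite-dimensional algebra, in the coordinates of a basis. -/
noncomputable def Algebra.normForm [Ring D] [Algebra F D] [Module.Finite F D] {m : ℕ}
    (b : Module.Basis (Fin m) F D) : MvPolynomial (Fin m) F :=
  (-1) ^ m * ((Algebra.lmul F D).toLinearMap.polyCharpoly b).coeff 0

section NormForm

variable [Ring D] [Algebra F D] [Module.Finite F D] {m : ℕ} (b : Module.Basis (Fin m) F D)

theorem Algebra.normForm_isHomogeneous : (Algebra.normForm b).IsHomogeneous m := by
  have h := LinearMap.polyCharpoly_coeff_isHomogeneous (Algebra.lmul F D).toLinearMap b 0 m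
    (by rw [Module.finrank_eq_card_basis b, Fintype.card_fin, zero_add])
  have h1 : ((-1) ^ m : MvPolynomial (Fin m) F) = MvPolynomial.C ((-1) ^ m) := by simp
  rw [Algebra.normForm, h1]
  exact h.C_mul _

/-- The norm form computes the norms of all base changes of the algebra, in particular that of the
generic element. -/
theorem Algebra.aeval_normForm {A : Type*} [Field A] [Algebra F A] (x : Fin m → A) :
    MvPolynomial.aeval x (Algebra.normForm b) =
      Algebra.norm A (∑ i, x i ⊗ₜ[F] b i : A ⊗[F] D) := by
  have h := congrArg (Polynomial.coeff · 0) (LinearMap.polyCharpolyAux_map_aeval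
    (Algebra.lmul F D).toLinearMap b (Module.Free.chooseBasis F D) A x)
  have h1 : (Algebra.TensorProduct.basis A b).repr.symm (Finsupp.equivFunOnFinite.symm x) =
      ∑ i, x i ⊗ₜ[F] b i := by
    rw [Module.Basis.repr_symm_apply, Finsupp.linearCombination_apply,
      Finsupp.sum_fintype _ _ (by simp)]
    simp [TensorProduct.smul_tmul']
  have h2 : LinearMap.tensorProduct F A D D ∘ₗ LinearMap.baseChange A (Algebra.lmul F D).toLinearMap
      = (Algebra.lmul A (A ⊗[F] D)).toLinearMap := by
    ext d d'
    simp [LinearMap.tensorProduct]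
  have h3 : Module.finrank A (A ⊗[F] D) = m := by
    rw [Module.finrank_eq_card_basis (Algebra.TensorProduct.basis A b), Fintype.card_fin]
  rw [h1, h2] at h
  simp only [Polynomial.coeff_map] at h
  rw [Algebra.normForm, Algebra.norm_apply, LinearMap.det_eq_sign_charpoly_coeff, map_mul, h3]
  congr 1
  simp

theorem Algebra.eval_normForm (x : Fin m → F) :
    MvPolynomial.eval x (Algebra.normForm b) = Algebra.norm F (∑ i, x i • b i) := by
  rw [Algebra.normForm, Algebra.norm_apply, LinearMap.det_eq_sign_charpoly_coeff, map_mul,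
    Module.finrank_eq_card_basis b, Fintype.card_fin]
  congr 1
  · simp
  · have := LinearMap.polyCharpoly_coeff_eval (Algebra.lmul F D).toLinearMap b (∑ i, x i • b i) 0
    rw [← AlgHom.toLinearMap_apply, ← this]
    congr 2
    ext i
    simp [Finsupp.single_apply]

end NormForm

/-- Finite-dimensional division algebras over a `C₁`-field are commutative. In the noncommutative
case the norm of the generic element is a proper power, so that the norm form, which has no
non-trivial zero and as many variables as its degree, is a power of a form of smaller degree. -/
theorem IsC1Field.mul_comm_of_finite (hF : IsC1Field F) [DivisionRing D] [Algebra F D]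
    [Module.Finite F D] (x y : D) : x * y = y * x := by
  by_contra hxy
  let m := Module.finrank F D
  let b := Module.finBasis F D
  obtain ⟨P, hP⟩ : ∃ P, P = Algebra.normForm b := ⟨_, rfl⟩
  have hPhom : P.IsHomogeneous m := hP ▸ Algebra.normForm_isHomogeneous b
  have hPeval : ∀ x, MvPolynomial.eval x P = Algebra.norm F (∑ i, x i • b i) :=
    hP ▸ Algebra.eval_normForm b
  let Q := FractionRing (MvPolynomial (Fin m) F)
  have hP1 : MvPolynomial.eval (b.repr 1) P = 1 := by
    rw [hPeval, b.sum_repr, map_one]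
  have hP0 : P ≠ 0 := by
    rintro h
    simp [h] at hP1
  have hdom : NoZeroDivisors (Q ⊗[F] D) := noZeroDivisors_fractionRing_tensor
  have hinj : Function.Injective (Algebra.TensorProduct.includeRight : D →ₐ[F] Q ⊗[F] D) :=
    Algebra.TensorProduct.includeRight_injective (algebraMap F Q).injective
  obtain ⟨c, k, hk, hc⟩ := Algebra.exists_norm_eq_pow (Q := Q) (B := Q ⊗[F] D)
    ⟨Algebra.TensorProduct.includeRight x, Algebra.TensorProduct.includeRight y, fun h =>
      hxy (hinj (by rw [map_mul, map_mul, h]))⟩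
    (∑ i, algebraMap (MvPolynomial (Fin m) F) Q (MvPolynomial.X i) ⊗ₜ b i)
  have hPQ : algebraMap (MvPolynomial (Fin m) F) Q P = c ^ k := by
    rw [← hc, ← Algebra.aeval_normForm, ← hP]
    have := MvPolynomial.aeval_algebraMap_apply (R := F) (B := Q)
      (MvPolynomial.X : Fin m → MvPolynomial (Fin m) F) P
    rw [MvPolynomial.aeval_X_left_apply] at this
    exact this.symm
  obtain ⟨ν, rfl⟩ := IsIntegrallyClosed.exists_algebraMap_eq_of_isIntegral_pow
    (R := MvPolynomial (Fin m) F) (x := c) (n := k) (by omega) (hPQ ▸ isIntegral_algebraMap)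
  rw [← map_pow] at hPQ
  obtain ⟨g, j, hg, hgP, hjk⟩ := MvPolynomial.exists_isHomogeneous_pow_eq hPhom hP0
    (IsFractionRing.injective _ Q hPQ).symm
  have hm : 0 < m := Module.finrank_pos
  have hj : 1 ≤ j := by
    rcases Nat.eq_zero_or_pos j with rfl | h
    · omega
    · exact h
  obtain ⟨z, hz0, hz⟩ := hF m j g hj (by nlinarith) hg
  have h1 : Algebra.norm F (∑ i, z i • b i) = 0 := by
    rw [← hPeval, ← hgP, map_pow, hz, zero_pow (by omega)]
  have h2 : ∑ i, z i • b i ≠ 0 := fun h =>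
    hz0 (funext (Fintype.linearIndependent_iff.mp b.linearIndependent z h))
  exact ((IsUnit.mk0 _ h2).map (Algebra.norm F)).ne_zero h1

end C1

/-! ### Endomorphisms of an extension of scalars -/

namespace ScalarExt

section EndTensor

variable {F A E K N : Type*} [Field F] [Ring A] [Algebra F A] [Field E] [Algebra F E]
  [Field K] [Algebra E K]
  [AddCommGroup N] [Module (E ⊗[F] A) N] [Module E N] [IsScalarTower E (E ⊗[F] A) N]

variable (F A K N) in
/-- The action of `K ⊗ End N` on `K ⊗ N`. -/
noncomputable def endTensorAction :
    K ⊗[E] Module.End (E ⊗[F] A) N →ₐ[E] Module.End K (K ⊗[E] N) :=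
  ((LinearMap.tensorProductEnd E K N).restrictScalars E).comp
    (Algebra.TensorProduct.map (AlgHom.id E K) (Algebra.lsmul E E N))

theorem endTensorAction_tmul (k x : K) (g : Module.End (E ⊗[F] A) N) (y : N) :
    endTensorAction F A K N (k ⊗ₜ g) (x ⊗ₜ y) = (k * x) ⊗ₜ[E] g y := by
  change k • (x ⊗ₜ[E] g y) = _
  rw [TensorProduct.smul_tmul', smul_eq_mul]

theorem endTensorAction_one_tmul (g : Module.End (E ⊗[F] A) N) :
    endTensorAction F A K N (1 ⊗ₜ g) = (g.restrictScalars E).baseChange K := by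
  ext y
  simp [endTensorAction_tmul]

theorem endTensorAction_injective : Function.Injective (endTensorAction F A (E := E) K N) := by
  classical
  let b := Module.Basis.ofVectorSpace E K
  rw [injective_iff_map_eq_zero]
  intro z hz
  -- In coordinates `z = ∑ b i ⊗ z i` acts on `1 ⊗ y` by `1 ⊗ y ↦ ∑ b i ⊗ z i y`.
  have key : ∀ z i y, TensorProduct.equivFinsuppOfBasisLeft b
      (endTensorAction F A K N z (1 ⊗ₜ y)) i =
        TensorProduct.equivFinsuppOfBasisLeft b z i y := by
    intro z i y
    induction z with
    | zero => simp
    | add z w hz hw => simp only [map_add, LinearMap.add_apply, Finsupp.add_apply, hz, hw]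
    | tmul k g =>
      rw [endTensorAction_tmul, TensorProduct.equivFinsuppOfBasisLeft_apply_tmul_apply,
        TensorProduct.equivFinsuppOfBasisLeft_apply_tmul_apply, mul_one, LinearMap.smul_apply]
  refine (TensorProduct.equivFinsuppOfBasisLeft b).injective ?_
  ext i y
  rw [← key, hz]
  simp

end EndTensor

section Endomorphisms

variable (F A : Type*) {E K N N' : Type*} [Field F] [Ring A] [Algebra F A] [Field E] [Algebra F E]
  [Field K] [Algebra F K] [Algebra E K] [IsScalarTower F E K]
  [AddCommGroup N] [Module (E ⊗[F] A) N] [Module E N] [IsScalarTower E (E ⊗[F] A) N]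
  [AddCommGroup N'] [Module (E ⊗[F] A) N'] [Module E N'] [IsScalarTower E (E ⊗[F] A) N']

theorem tmul_smul_ofTensor (k : K) (a : A) (w : K ⊗[E] N) :
    (k ⊗ₜ[F] a) • ofTensor E K N w = ofTensor E K N (k • rightAction F A E K N a w) := by
  induction w with
  | zero => simp
  | add x y hx hy => rw [map_add, smul_add, hx, hy, map_add, smul_add, map_add]
  | tmul x y => rw [smul_tmul]; rfl

/-- A `K`-linear map that commutes with the action of `A` is `A_K`-linear. -/
noncomputable def homOfCommute (T : K ⊗[E] N →ₗ[K] K ⊗[E] N')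
    (hT : ∀ (a : A) w, T (rightAction F A E K N a w) = rightAction F A E K N' a (T w)) :
    ScalarExt E K N →ₗ[K ⊗[F] A] ScalarExt E K N' where
  toFun v := ofTensor E K N' (T ((ofTensor E K N).symm v))
  map_add' v w := by simp only [map_add]
  map_smul' z v := by
    obtain ⟨w, rfl⟩ := (ofTensor E K N).surjective v
    rw [RingHom.id_apply, AddEquiv.symm_apply_apply]
    induction z with
    | zero => simp
    | add x y hx hy => rw [add_smul, add_smul, map_add, map_add, map_add, hx, hy]
    | tmul k a =>
      rw [tmul_smul_ofTensor, AddEquiv.symm_apply_apply, tmul_smul_ofTensor, map_smul, hT]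

theorem rightAction_tmul (a : A) (x : K) (y : N) :
    rightAction F A E K N a (x ⊗ₜ y) = x ⊗ₜ[E] (((1 : E) ⊗ₜ[F] a : E ⊗[F] A) • y) :=
  rfl

/-- The extension of scalars of a homomorphism of `A_E`-modules. -/
noncomputable def map (g : N →ₗ[E ⊗[F] A] N') : ScalarExt E K N →ₗ[K ⊗[F] A] ScalarExt E K N' :=
  homOfCommute F A ((g.restrictScalars E).baseChange K) fun a w => by
    induction w with
    | zero => simp
    | add x y hx hy => simp only [map_add, hx, hy]
    | tmul x y => simp [rightAction_tmul]

variable {F A}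

theorem endTensorAction_commute (z : K ⊗[E] Module.End (E ⊗[F] A) N) (a : A) (w : K ⊗[E] N) :
    endTensorAction F A K N z (rightAction F A E K N a w) =
      rightAction F A E K N a (endTensorAction F A K N z w) := by
  induction z with
  | zero => simp
  | add x y hx hy => simp only [map_add, LinearMap.add_apply, hx, hy]
  | tmul k g =>
    induction w with
    | zero => simp
    | add x y hx hy => simp only [map_add, hx, hy]
    | tmul x y => simp only [rightAction_tmul, endTensorAction_tmul, map_smul]

/-- For finite-dimensional `N` each `A`-linear endomorphism of `K ⊗ N` comes from `K ⊗ End N`: its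
coordinates with respect to a basis of `K` are endomorphisms of `N`, and almost all of them
vanish. -/
theorem exists_endTensorAction_eq [Module.Finite E N] (T : Module.End K (K ⊗[E] N))
    (hT : ∀ (a : A) w, T (rightAction F A E K N a w) = rightAction F A E K N a (T w)) :
    ∃ z, endTensorAction F A K N z = T := by
  classical
  let b := Module.Basis.ofVectorSpace E K
  let c := TensorProduct.equivFinsuppOfBasisLeft (N := N) b
  have hc : ∀ (a : A) w i, c (rightAction F A E K N a w) i =
      ((1 : E) ⊗ₜ[F] a : E ⊗[F] A) • c w i := by
    intro a w i
    induction w with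
    | zero => simp
    | add x y hx hy => simp only [map_add, Finsupp.add_apply, hx, hy, smul_add]
    | tmul x y =>
      simp only [c, rightAction_tmul, TensorProduct.equivFinsuppOfBasisLeft_apply_tmul_apply]
      rw [smul_comm]
  let t : (i : _) → N →ₗ[E] N := fun i =>
    Finsupp.lapply i ∘ₗ c.toLinearMap ∘ₗ T.restrictScalars E ∘ₗ TensorProduct.mk E K N 1
  have ht : ∀ i y, t i y = c (T (1 ⊗ₜ y)) i := fun i y => rfl
  let t' : (i : _) → Module.End (E ⊗[F] A) N := fun i =>
    { t i with
      map_smul' := fun β y => by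
        simp only [AddHom.toFun_eq_coe, LinearMap.coe_toAddHom, RingHom.id_apply]
        induction β with
        | zero => simp
        | add β γ h1 h2 => rw [add_smul, map_add, h1, h2, add_smul]
        | tmul e a =>
          have h1 : e ⊗ₜ[F] a = e • ((1 : E) ⊗ₜ[F] a) := by
            rw [TensorProduct.smul_tmul', smul_eq_mul, mul_one]
          rw [h1, smul_assoc, smul_assoc, map_smul, ht, ht, ← hc, ← hT, rightAction_tmul] }
  have ht' : ∀ i y, t' i y = c (T (1 ⊗ₜ y)) i := fun i y => rfl
  obtain ⟨S, hS⟩ := Module.Finite.fg_top (R := E) (M := N)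
  let s := S.biUnion fun y => (c (T (1 ⊗ₜ y))).support
  have hs : ∀ y, (c (T (1 ⊗ₜ y))).support ⊆ s := by
    intro y
    have hy : y ∈ Submodule.span E (S : Set N) := hS ▸ Submodule.mem_top
    induction hy using Submodule.span_induction with
    | mem y hy => exact Finset.subset_biUnion_of_mem (fun y => (c (T (1 ⊗ₜ y))).support) hy
    | zero => simp
    | add x y _ _ hx hy =>
      rw [TensorProduct.tmul_add, map_add, map_add]
      exact Finsupp.support_add.trans (Finset.union_subset hx hy)
    | smul e y _ hy =>
      rw [TensorProduct.tmul_smul, LinearMap.map_smul_of_tower, map_smul]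
      exact Finsupp.support_smul.trans hy
  refine ⟨∑ i ∈ s, b i ⊗ₜ t' i, ?_⟩
  ext y
  simp only [TensorProduct.AlgebraTensorModule.curry_apply, TensorProduct.curry_apply,
    LinearMap.restrictScalars_apply, map_sum, LinearMap.sum_apply,
    endTensorAction_tmul, mul_one, ht']
  refine Eq.trans ?_ (c.symm_apply_apply (T (1 ⊗ₜ y)))
  rw [TensorProduct.equivFinsuppOfBasisLeft_symm_apply,
    Finsupp.sum_of_support_subset _ (hs y) _ (by simp)]

variable (F A K N) in
/-- `K ⊗ End N → End (K ⊗ N)` as a ring homomorphism into the `A_K`-linear endomorphisms. -/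
noncomputable def endTensorHom :
    K ⊗[E] Module.End (E ⊗[F] A) N →+* Module.End (K ⊗[F] A) (ScalarExt E K N) where
  toFun z := homOfCommute F A (endTensorAction F A K N z) (endTensorAction_commute z)
  map_one' := by ext v; simp [homOfCommute]
  map_mul' y z := by ext v; simp [homOfCommute]
  map_zero' := by ext v; simp [homOfCommute]
  map_add' y z := by ext v; simp [homOfCommute]

theorem endTensorHom_injective : Function.Injective (endTensorHom F A (E := E) K N) := by
  intro y z h
  refine endTensorAction_injective (LinearMap.ext fun w => ?_)
  simpa [endTensorHom, homOfCommute] using LinearMap.congr_fun h (ofTensor E K N w)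

theorem endTensorHom_surjective [Module.Finite E N] :
    Function.Surjective (endTensorHom F A (E := E) K N) := by
  intro T
  let T' : Module.End K (K ⊗[E] N) :=
    { toFun := fun w => (ofTensor E K N).symm (T (ofTensor E K N w))
      map_add' := fun v w => by simp only [map_add]
      map_smul' := fun k w => by
        have h := tmul_smul_ofTensor F A k 1 w
        have h' := tmul_smul_ofTensor F A k 1 ((ofTensor E K N).symm (T (ofTensor E K N w)))
        rw [map_one, Module.End.one_apply] at h h'
        rw [← h, map_smul, RingHom.id_apply, AddEquiv.symm_apply_eq, ← h',
          AddEquiv.apply_symm_apply] }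
  obtain ⟨z, hz⟩ := exists_endTensorAction_eq (F := F) (A := A) T' fun a w => by
    have h := tmul_smul_ofTensor F A 1 a w
    have h' := tmul_smul_ofTensor F A 1 a ((ofTensor E K N).symm (T (ofTensor E K N w)))
    rw [one_smul] at h h'
    change (ofTensor E K N).symm (T (ofTensor E K N _)) = _
    rw [← h, map_smul, AddEquiv.symm_apply_eq]
    change _ = ofTensor E K N (rightAction F A E K N a ((ofTensor E K N).symm _))
    rw [← h', AddEquiv.apply_symm_apply]
  refine ⟨z, LinearMap.ext fun v => ?_⟩
  simp [endTensorHom, homOfCommute, hz, T']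

theorem endTensorHom_one_tmul (g : Module.End (E ⊗[F] A) N) :
    endTensorHom F A K N (1 ⊗ₜ g) = map F A g := by
  ext v
  simp only [endTensorHom, map, RingHom.coe_mk, MonoidHom.coe_mk, OneHom.coe_mk,
    endTensorAction_one_tmul]

theorem map_comp {N'' : Type*} [AddCommGroup N''] [Module (E ⊗[F] A) N''] [Module E N'']
    [IsScalarTower E (E ⊗[F] A) N''] (g : N' →ₗ[E ⊗[F] A] N'') (f : N →ₗ[E ⊗[F] A] N') :
    map F A (K := K) (g ∘ₗ f) = map F A g ∘ₗ map F A f := by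
  ext v
  obtain ⟨w, rfl⟩ := (ofTensor E K N).surjective v
  induction w with
  | zero => simp
  | add x y hx hy => rw [map_add, map_add, map_add, hx, hy]
  | tmul x y => rfl

theorem map_id : map F A (K := K) (LinearMap.id : N →ₗ[E ⊗[F] A] N) = LinearMap.id := by
  ext v
  obtain ⟨w, rfl⟩ := (ofTensor E K N).surjective v
  induction w with
  | zero => simp
  | add x y hx hy => rw [map_add, map_add, map_add, hx, hy]
  | tmul x y => rfl

end Endomorphisms

end ScalarExt

/-! ### Descent -/

/-- The first summand of a direct sum of `n` copies of `M` is the image of an `n`-th part of the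
identity. -/
theorem LinearEquiv.exists_isNthPart {S M V : Type*} [Ring S] [AddCommGroup M] [Module S M]
    [AddCommGroup V] [Module S V] {n : ℕ} [NeZero n] (φ : (Fin n → M) ≃ₗ[S] V) :
    ∃ (ι : M →ₗ[S] V) (π : V →ₗ[S] M), π ∘ₗ ι = LinearMap.id ∧
      IsNthPart (S := Module.End S V) n (ι ∘ₗ π) := by
  classical
  let ι : Fin n → M →ₗ[S] V := fun p => φ.toLinearMap ∘ₗ LinearMap.single S (fun _ => M) p
  let π : Fin n → V →ₗ[S] M := fun p => LinearMap.proj p ∘ₗ φ.symm.toLinearMap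
  have hπι : ∀ p q, π p ∘ₗ ι q = if p = q then LinearMap.id else 0 := by
    intro p q
    ext x
    split_ifs with h
    · subst h; simp [π, ι]
    · simp [π, ι, h]
  have hιπ : ∑ p, ι p ∘ₗ π p = LinearMap.id := by
    ext v
    have h : ∑ p, Pi.single p (φ.symm v p) = φ.symm v := Finset.univ_sum_single _
    simp [π, ι, ← map_sum, h]
  refine ⟨ι 0, π 0, by rw [hπι, if_pos rfl], fun p => ι p ∘ₗ π 0, fun p => ι 0 ∘ₗ π p, ?_, ?_⟩
  · intro p q
    rw [Module.End.mul_eq_comp, LinearMap.comp_assoc, ← LinearMap.comp_assoc (π 0) (ι q) (π p),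
      hπι]
    split_ifs <;> simp
  · have : ∀ p, (ι p ∘ₗ π 0 : Module.End S V) * (ι 0 ∘ₗ π p) = ι p ∘ₗ π p := by
      intro p
      rw [Module.End.mul_eq_comp, LinearMap.comp_assoc, ← LinearMap.comp_assoc (π p) (ι 0) (π 0),
        hπι, if_pos rfl, LinearMap.id_comp]
    simp only [this, hιπ]
    rfl

/-- Let `E` be a field all of whose finite-dimensional division algebras are commutative, and let
`N` be a finite-dimensional `A_E`-module. If `K ⊗ N` is a direct sum of `n` copies of `M`, then `M`
is the extension of scalars of a submodule of `N`. -/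
theorem ScalarExt.exists_submodule_of_linearEquiv {F A E K M : Type*} {N : Type uM} [Field F]
    [Ring A] [Algebra F A] [Field E] [Algebra F E] [Field K] [Algebra F K] [Algebra E K]
    [IsScalarTower F E K] [AddCommGroup N] [Module (E ⊗[F] A) N] [Module E N]
    [IsScalarTower E (E ⊗[F] A) N] [Module.Finite E N] [AddCommGroup M] [Module (K ⊗[F] A) M]
    (hE : ∀ (D : Type uM) [DivisionRing D] [Algebra E D] [Module.Finite E D] (x y : D),
      x * y = y * x)
    {n : ℕ} [NeZero n] (φ : (Fin n → M) ≃ₗ[K ⊗[F] A] ScalarExt E K N) :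
    ∃ N' : Submodule (E ⊗[F] A) N, Nonempty (M ≃ₗ[K ⊗[F] A] ScalarExt E K N') := by
  let R := Module.End (E ⊗[F] A) N
  have hR : Module.Finite E R := Module.Finite.of_injective
    (LinearMap.restrictScalarsₗ E (E ⊗[F] A) N N E) (LinearMap.restrictScalars_injective E)
  let Φ : K ⊗[E] R ≃+* Module.End (K ⊗[F] A) (ScalarExt E K N) :=
    RingEquiv.ofBijective (ScalarExt.endTensorHom F A K N)
      ⟨ScalarExt.endTensorHom_injective, ScalarExt.endTensorHom_surjective⟩
  obtain ⟨ι, π, hπι, he⟩ := φ.exists_isNthPart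
  obtain ⟨f, hf, hef⟩ := (he.map (Φ.symm : _ →+* K ⊗[E] R)).exists_idemEquiv_tmul hE
  have hef' := hef.map (Φ : K ⊗[E] R →+* Module.End (K ⊗[F] A) (ScalarExt E K N))
  obtain ⟨a, b, hab, hba⟩ := hef'
  replace hab : a ∘ₗ b = ι ∘ₗ π := by simpa [Module.End.mul_eq_comp] using hab
  replace hba : b ∘ₗ a = ScalarExt.map F A f := by
    rw [← ScalarExt.endTensorHom_one_tmul]; exact hba
  -- The image of `f` is the descent of `M`.
  let N' := LinearMap.range f
  let i : N' →ₗ[E ⊗[F] A] N := N'.subtype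
  let r : N →ₗ[E ⊗[F] A] N' := f.rangeRestrict
  have hir : i ∘ₗ r = f := by ext; rfl
  have hri : r ∘ₗ i = LinearMap.id := by
    ext ⟨x, y, rfl⟩
    exact LinearMap.congr_fun hf.eq y
  have hir' := congrArg (ScalarExt.map F A (K := K)) hir
  have hri' := congrArg (ScalarExt.map F A (K := K)) hri
  rw [ScalarExt.map_comp] at hir' hri'
  rw [ScalarExt.map_id] at hri'
  refine ⟨N', ⟨?_⟩⟩
  refine LinearEquiv.ofLinearMap (ScalarExt.map F A r ∘ₗ b ∘ₗ ι) (π ∘ₗ a ∘ₗ ScalarExt.map F A i)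
    ?_ ?_
  · -- `r b ι π a i = r b a b a i = r f f i`
    ext v
    have h1 := fun w => LinearMap.congr_fun hab w
    have h2 := fun w => LinearMap.congr_fun hba w
    have h3 := fun w => LinearMap.congr_fun hir' w
    have h4 := fun w => LinearMap.congr_fun hri' w
    simp only [LinearMap.comp_apply, LinearMap.id_apply] at h1 h2 h3 h4 ⊢
    rw [← h1, h2, h2, ← h3, ← h3, h4, h4, h4]
  · ext v
    have h1 := fun w => LinearMap.congr_fun hab w
    have h2 := fun w => LinearMap.congr_fun hba w
    have h3 := fun w => LinearMap.congr_fun hir' w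
    have h4 := fun w => LinearMap.congr_fun hπι w
    simp only [LinearMap.comp_apply, LinearMap.id_apply] at h1 h2 h3 h4 ⊢
    rw [h3, ← h2, h1, h1, h4, h4, h4]

theorem proposition2p4 {F : Type uF} {A : Type uA} {K : Type uK} {M : Type uM}
    [Field F] (hF : IsC1Field F)
    [Ring A] [Algebra F A] [Module.Finite F A]
    [Field K] [Algebra F K]
    [AddCommGroup M] [Module (K ⊗[F] A) M] [Module.Finite (K ⊗[F] A) M]
    (K₀ : IntermediateField F K) [FiniteDimensional F K₀]
    (n : ℕ) (hn : 1 ≤ n) (h : DescendsTo A (Fin n → M) K₀) :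
    DescendsTo A M K₀ := by
  have : NeZero n := ⟨by omega⟩
  obtain ⟨N, _, _, _, _, _, ⟨φ⟩⟩ := h
  have hN : Module.Finite K₀ N := Module.Finite.trans (K₀ ⊗[F] A) N
  obtain ⟨N', ⟨ψ⟩⟩ := ScalarExt.exists_submodule_of_linearEquiv (fun D _ _ _ x y => by
    let _ : Algebra F D := Algebra.compHom D (algebraMap F K₀)
    have : IsScalarTower F K₀ D := IsScalarTower.of_algebraMap_eq fun _ => rfl
    have : Module.Finite F D := Module.Finite.trans K₀ D
    exact hF.mul_comm_of_finite x y) φ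
  have hN' : Module.Finite K₀ N' :=
    Module.Finite.of_injective (N'.subtype.restrictScalars K₀) N'.injective_subtype
  exact ⟨N', inferInstance, inferInstance, inferInstance, inferInstance,
    Module.Finite.of_restrictScalars_finite K₀ _ _, ⟨ψ⟩⟩
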